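/- Let $t$ and $q$ be elements of a commutative ring $R$ (for example, indeterminates, with $R=\mathbb{Z}[t,q]$). Define the $(q,t)$-Catalan numbers $C_n(t,q)\in R$, $n\ge 0$, as the coefficients of the formal power series expansion in $z$ of the Stieltjes continued fraction $$ \sum_{n\ge 0} C_n(t,q)\,z^n=\cfrac{1}{1-\cfrac{z}{1-\cfrac{tz}{1-\cfrac{qz}{1-\cfrac{tqz}{1-\cfrac{q^2z}{1-\cfrac{tq^2z}{\ddots}}}}}}}, $$ whose successive partial numerators are $z, tz, qz, tqz, \ldots, q^{k-1}z, tq^{k-1}z,\ldots$ Let $\mathfrak{S}_n$ be the set of permutations $\pi=\pi(1)\pi(2)\cdots\pi(n)$ of $\{1,\dots,n\}$, and for $\tau\in\mathfrak{S}_3$ let $\mathfrak{S}_n(\tau)$ be the set of those $\pi\in\mathfrak{S}_n$ that have no subsequence $\pi(i_1)\pi(i_2)\pi(i_3)$, $i_1<i_2<i_3$, order-isomorphic to $\tau$. For $\pi\in\mathfrak{S}_n$ put \begin{align*} \mathsf{des}\,\pi&=\#\{i: 1\le i<n,\ \pi(i)>\pi(i+1)\},\\ (31\text{-}2)\,\pi&=\#\{(i,j):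 1\le i,\ i+1<j\le n,\ \pi(i+1)<\pi(j)<\pi(i)\},\\ (2\text{-}31)\,\pi&=\#\{(i,j): 1\le j<i<n,\ \pi(i+1)<\pi(j)<\pi(i)\},\\ (2\text{-}13)\,\pi&=\#\{(i,j): 1\le j<i<n,\ \pi(i)<\pi(j)<\pi(i+1)\},\\ (13\text{-}2)\,\pi&=\#\{(i,j): 1\le i,\ i+1<j\le n,\ \pi(i)<\pi(j)<\pi(i+1)\}. \end{align*} Let $\mathsf{adi}\,\pi$ be the number of pairs $1\le i<j\le n$ with $\pi(i)>\pi(j)$ such that $j<n$ and $\pi(j)<\pi(j+1)$, or $\pi(l)<\pi(j)$ for some $i<l<j$. Let $\mathsf{adi}^*\,\pi$ be the number of pairs $1\le i<j\le n$ with $\pi(i)>\pi(j)$ such that $i>1$ and $\pi(i-1)<\pi(i)$, or $\pi(l)>\pi(i)$ for some $i<l<j$. Then for every $n\ge 0$, $$ C_n(t,q)=\sum_{\pi\in\mathfrak{S}_n(\tau)}t^{\mathsf{des}\,\pi}q^{\mathsf{stat}\,\pi} $$ for each of the following ten pairs $(\tau,\mathsf{stat})$: $$ \begin{gathered} (231,\,13\text{-}2),\quad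 (231,\,\mathsf{adi}^*),\quad (312,\,2\text{-}13),\quad (312,\,\mathsf{adi}),\quad (213,\,31\text{-}2),\\ (132,\,2\text{-}31),\quad (231,\,31\text{-}2),\quad (312,\,2\text{-}31),\quad (213,\,13\text{-}2),\quad (132,\,2\text{-}13). \end{gathered} $$ -/

import Mathlib

namespace QTCatalan

open scoped Finset PowerSeries

section ContinuedFraction

variable {R : Type*} [CommRing R]

/-- The `N`-th convergent of the formal Stieltjes continued fraction
`1 / (1 - c 0 * z / (1 - c 1 * z / (1 - c 2 * z / ⋯)))`, a power series in `z`: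
the fraction is cut off after the partial numerator `c (N - 1) * z`.
Every denominator has constant coefficient `1`, and `invOfUnit _ 1` is its inverse. -/
noncomputable def convergent : ℕ → (ℕ → R) → R⟦X⟧
  | 0, _ => 1
  | N + 1, c =>
      PowerSeries.invOfUnit
        (1 - PowerSeries.C (c 0) * PowerSeries.X * convergent N (fun k => c (k + 1))) 1

/-- The power series expansion of the infinite Stieltjes continued fraction
`1 / (1 - c 0 * z / (1 - c 1 * z / (1 - c 2 * z / ⋯)))`: the coefficientwise (eventually
constant) limit of its convergents, see `coeff_convergent_eq` and `stieltjesCF_unfold`. -/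
noncomputable def stieltjesCF (c : ℕ → R) : R⟦X⟧ :=
  PowerSeries.mk fun n => PowerSeries.coeff n (convergent n c)

theorem denom_mul_inv (a : R) (f : R⟦X⟧) :
    (1 - PowerSeries.C a * PowerSeries.X * f) *
      PowerSeries.invOfUnit (1 - PowerSeries.C a * PowerSeries.X * f) 1 = 1 := by
  apply PowerSeries.mul_invOfUnit
  simp

theorem X_pow_dvd_convergent_sub (N : ℕ) (c : ℕ → R) :
    (PowerSeries.X : R⟦X⟧) ^ (N + 1) ∣ convergent (N + 1) c - convergent N c := by
  induction N generalizing c with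
  | zero =>
    have h := denom_mul_inv (c 0) (convergent 0 fun k => c (k + 1))
    refine ⟨PowerSeries.C (c 0) * convergent 1 c, ?_⟩
    simp only [convergent] at h ⊢
    linear_combination h
  | succ N ih =>
    obtain ⟨g, hg⟩ := ih (fun k => c (k + 1))
    have h1 := denom_mul_inv (c 0) (convergent (N + 1) fun k => c (k + 1))
    have h2 := denom_mul_inv (c 0) (convergent N fun k => c (k + 1))
    change _ * convergent (N + 2) c = 1 at h1
    change _ * convergent (N + 1) c = 1 at h2
    refine ⟨PowerSeries.C (c 0) * g * convergent (N + 2) c * convergent (N + 1) c, ?_⟩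
    linear_combination convergent (N + 1) c * h1 - convergent (N + 2) c * h2
      + PowerSeries.C (c 0) * PowerSeries.X * convergent (N + 2) c * convergent (N + 1) c * hg

/-- The coefficient of `z ^ n` is the same in all convergents from the `n`-th on. -/
theorem coeff_convergent_eq (c : ℕ → R) {n N : ℕ} (h : n ≤ N) :
    PowerSeries.coeff n (convergent N c) = PowerSeries.coeff n (stieltjesCF c) := by
  induction N, h using Nat.le_induction with
  | base => simp [stieltjesCF]
  | succ N hN ih =>
    have := PowerSeries.X_pow_dvd_iff.1 (X_pow_dvd_convergent_sub N c) n (by omega)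
    rw [map_sub, sub_eq_zero] at this
    rw [this, ih]

/-- The continued fraction satisfies `F(c 0, c 1, …) = 1 / (1 - c 0 * z * F(c 1, c 2, …))`. -/
theorem stieltjesCF_unfold (c : ℕ → R) :
    (1 - PowerSeries.C (c 0) * PowerSeries.X * stieltjesCF (fun k => c (k + 1))) *
      stieltjesCF c = 1 := by
  ext n
  have h := congrArg (PowerSeries.coeff n)
    (denom_mul_inv (c 0) (convergent n fun k => c (k + 1)))
  change PowerSeries.coeff n (_ * convergent (n + 1) c) = _ at h
  rw [← h, PowerSeries.coeff_mul, PowerSeries.coeff_mul]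
  refine Finset.sum_congr rfl fun p hp => ?_
  have hp' := Finset.HasAntidiagonal.mem_antidiagonal.1 hp
  rw [coeff_convergent_eq c (show p.2 ≤ n + 1 by omega)]
  congr 1
  rw [map_sub, map_sub, mul_assoc, mul_assoc, PowerSeries.coeff_C_mul, PowerSeries.coeff_C_mul]
  rcases hp1 : p.1 with _ | m
  · simp
  · rw [PowerSeries.coeff_succ_X_mul, PowerSeries.coeff_succ_X_mul,
      coeff_convergent_eq _ (show m ≤ n by omega)]

/-- The sequence `1, t, q, t * q, q ^ 2, t * q ^ 2, …`. -/
def catCoeff (t q : R) (k : ℕ) : R :=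
  if Even k then q ^ (k / 2) else t * q ^ (k / 2)

/-- The `(q,t)`-Catalan number `C_n(t,q)`: the coefficient of `z ^ n` in the Stieltjes continued
fraction with successive partial numerators `z, t z, q z, t q z, q ^ 2 z, t q ^ 2 z, …`. -/
noncomputable def qtCatalan (n : ℕ) (t q : R) : R :=
  PowerSeries.coeff n (stieltjesCF (catCoeff t q))

end ContinuedFraction

section Statistics

/-! A permutation of length `n` is `π : Equiv.Perm (Fin n)`, with one-line notation
`π 0, π 1, …, π (n - 1)`. Indices and values are shifted down by one; all notions below
depend on relative order only. -/

/-- `π` avoids the pattern with one-line notation `p`: no subsequence of `π` is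
order-isomorphic to `p`. -/
def Avoids {n k : ℕ} (π : Equiv.Perm (Fin n)) (p : Fin k → ℕ) : Prop :=
  ¬ ∃ f : Fin k → Fin n, StrictMono f ∧ ∀ a b : Fin k, π (f a) < π (f b) ↔ p a < p b

open Classical in
/-- The set of permutations of length `n` that avoid the pattern `p`. -/
noncomputable def avoiders (n : ℕ) {k : ℕ} (p : Fin k → ℕ) : Finset (Equiv.Perm (Fin n)) :=
  {π | Avoids π p}

variable {n : ℕ}

/-- Number of descents: positions `i` followed by a position `i' = i + 1` with a smaller letter. -/
def des (π : Equiv.Perm (Fin n)) : ℕ :=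
  #{i : Fin n | ∃ i' : Fin n, i'.val = i.val + 1 ∧ π i' < π i}

/-- Occurrences of the vincular pattern `31-2`: pairs `(i, j)` with `i + 1 < j` and
`π (i + 1) < π j < π i`. -/
def vinc31_2 (π : Equiv.Perm (Fin n)) : ℕ :=
  #{x : Fin n × Fin n | ∃ i' : Fin n, i'.val = x.1.val + 1 ∧
    i' < x.2 ∧ π i' < π x.2 ∧ π x.2 < π x.1}

/-- Occurrences of the vincular pattern `2-31`: pairs `(i, j)` with `j < i` and
`π (i + 1) < π j < π i`. -/
def vinc2_31 (π : Equiv.Perm (Fin n)) : ℕ :=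
  #{x : Fin n × Fin n | ∃ i' : Fin n, i'.val = x.1.val + 1 ∧
    x.2 < x.1 ∧ π i' < π x.2 ∧ π x.2 < π x.1}

/-- Occurrences of the vincular pattern `2-13`: pairs `(i, j)` with `j < i` and
`π i < π j < π (i + 1)`. -/
def vinc2_13 (π : Equiv.Perm (Fin n)) : ℕ :=
  #{x : Fin n × Fin n | ∃ i' : Fin n, i'.val = x.1.val + 1 ∧
    x.2 < x.1 ∧ π x.1 < π x.2 ∧ π x.2 < π i'}

/-- Occurrences of the vincular pattern `13-2`: pairs `(i, j)` with `i + 1 < j` and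
`π i < π j < π (i + 1)`. -/
def vinc13_2 (π : Equiv.Perm (Fin n)) : ℕ :=
  #{x : Fin n × Fin n | ∃ i' : Fin n, i'.val = x.1.val + 1 ∧
    i' < x.2 ∧ π x.1 < π x.2 ∧ π x.2 < π i'}

/-- Number of admissible inversions: inversions `(π i, π j)` such that `π j < π (j + 1)`, or
`π l < π j` for some `i < l < j`. By the boundary convention that the letter after the last one
is smaller than all letters, the first condition fails when `j` is the last position. -/
def adi (π : Equiv.Perm (Fin n)) : ℕ :=
  #{x : Fin n × Fin n | x.1 < x.2 ∧ π x.2 < π x.1 ∧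
    ((∃ j' : Fin n, j'.val = x.2.val + 1 ∧ π x.2 < π j') ∨
      ∃ l : Fin n, x.1 < l ∧ l < x.2 ∧ π l < π x.2)}

/-- Number of star admissible inversions: inversions `(π i, π j)` such that `π (i - 1) < π i`, or
`π i < π l` for some `i < l < j`. By the boundary convention that the letter before the first one
is larger than all letters, the first condition fails when `i` is the first position. -/
def adiStar (π : Equiv.Perm (Fin n)) : ℕ :=
  #{x : Fin n × Fin n | x.1 < x.2 ∧ π x.2 < π x.1 ∧
    ((∃ i' : Fin n, i'.val + 1 = x.1.val ∧ π i' < π x.1) ∨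
      ∃ l : Fin n, x.1 < l ∧ l < x.2 ∧ π x.1 < π l)}

/-- The sum of `t ^ des π * q ^ stat π` over the permutations `π` of length `n` avoiding `τ`. -/
noncomputable def avoidSum {R : Type*} [CommRing R] (t q : R) (τ : Fin 3 → ℕ)
    (stat : Equiv.Perm (Fin n) → ℕ) : R :=
  ∑ π ∈ avoiders n τ, t ^ des π * q ^ stat π

end Statistics

end QTCatalan

/-! Let `F(z)` be the continued fraction. From the third partial numerator on, the sequence of
numerators is `q` times the whole sequence, and scaling all numerators by `q` substitutes `qz` for
`z`. Hence `F = 1 / (1 - z G)` with `G = 1 / (1 - t z F(qz))`, and eliminating `G` gives `F = 1 + z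
(F + t F(qz) (F - 1))` (`isCatalanSeries_stieltjesCF`). This equation determines the coefficients
recursively (`IsCatalanSeries.unique`), so it suffices to verify it for generating functions of
permutations.

Only permutations avoiding `231` need to be counted. Such a word splits at its largest letter as `u
m v` with `u < v` letterwise (`sum_words_succ_max`), and at its first letter as `a u v` with `u < a
< v` (`sum_words_succ_first`). The first splitting suits `13-2`, the second suits `31-2`. Each is
carried out with `t` marking descents and with `t` marking ascents, which gives the four sums
`qtCatalan_eq_sum_des_13_2`, `qtCatalan_eq_sum_asc_13_2`, `qtCatalan_eq_sum_des_31_2` and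
`qtCatalan_eq_sum_asc_31_2`.

The two descent sums are the pairs `(231, 13-2)` and `(231, 31-2)`. On `231`-avoiders `adi*` equals
`13-2` (`adiStar_eq_vinc13_2`). Complementation turns the two ascent sums into the two pairs with
`213`, and reverse-complementation, which preserves descents, carries these five pairs to the other
five. -/

namespace QTCatalan

open scoped Finset PowerSeries

/-! ### Words avoiding `231` and their two decompositions -/

section Words

/-- A word avoids `231`. -/
def WordAvoids231 : List ℕ → Prop
  | [] => True
  | x :: l => l.Pairwise (fun y z => ¬ (z < x ∧ x < y)) ∧ WordAvoids231 l

open Classical in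
/-- The words avoiding `231` that use each of the letters `s, …, s + n - 1` once. -/
noncomputable def words (s n : ℕ) : Finset (List ℕ) :=
  (List.range' s n).permutations.toFinset.filter WordAvoids231

theorem mem_words {s n : ℕ} {l : List ℕ} :
    l ∈ words s n ↔ l.Perm (List.range' s n) ∧ WordAvoids231 l := by
  simp [words]

theorem words_zero (s : ℕ) : words s 0 = {[]} := by
  ext l
  simp only [mem_words, List.range'_zero, List.perm_nil, Finset.mem_singleton]
  exact ⟨fun h => h.1, fun h => ⟨h, h ▸ trivial⟩⟩

theorem length_of_mem_words {s n : ℕ} {l : List ℕ} (h : l ∈ words s n) : l.length = n := by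
  simpa using (mem_words.1 h).1.length_eq

theorem mem_of_mem_words {s n : ℕ} {l : List ℕ} (h : l ∈ words s n) {x : ℕ} :
    x ∈ l ↔ s ≤ x ∧ x < s + n := by
  rw [(mem_words.1 h).1.mem_iff, List.mem_range'_1]

theorem pairwise_of_forall_mem {α : Type*} {r : α → α → Prop} {l : List α}
    (h : ∀ x ∈ l, ∀ y ∈ l, r x y) : l.Pairwise r :=
  List.pairwise_iff_forall_sublist.2 fun hs =>
    h _ (hs.subset (by simp)) _ (hs.subset (by simp))

theorem wordAvoids231_append {l₁ l₂ : List ℕ} (h : ∀ x ∈ l₁, ∀ y ∈ l₂, x < y) :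
    WordAvoids231 (l₁ ++ l₂) ↔ WordAvoids231 l₁ ∧ WordAvoids231 l₂ := by
  induction l₁ with
  | nil => simp [WordAvoids231]
  | cons a l₁ ih =>
    have h2 : ∀ y ∈ l₂, a < y := h a (by simp)
    have h3 : ∀ x ∈ l₁, ∀ y ∈ l₂, x < y := fun x hx => h x (by simp [hx])
    have h4 : l₂.Pairwise (fun y z => ¬ (z < a ∧ a < y)) :=
      pairwise_of_forall_mem fun y _ z hz => by have := h2 z hz; omega
    simp only [List.cons_append, WordAvoids231, ih h3, List.pairwise_append]
    constructor
    · tauto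
    · rintro ⟨⟨h5, h6⟩, h7⟩
      exact ⟨⟨h5, h4, fun x _ y hy => by have := h2 y hy; omega⟩, h6, h7⟩

theorem wordAvoids231_cons_of_lt {m : ℕ} {l : List ℕ} (h : ∀ x ∈ l, x < m) :
    WordAvoids231 (m :: l) ↔ WordAvoids231 l := by
  simp only [WordAvoids231, and_iff_right_iff_imp]
  exact fun _ => pairwise_of_forall_mem fun y hy z _ => by have := h y hy; omega

/-- If `y < x`, then `x`, `m`, `y` would form a `231`. The inequality is weak because letters may
repeat here. -/
theorem WordAvoids231.le_of_append_cons {m : ℕ} {l₁ l₂ : List ℕ}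
    (h : WordAvoids231 (l₁ ++ m :: l₂)) (h₁ : ∀ x ∈ l₁, x < m) :
    ∀ x ∈ l₁, ∀ y ∈ l₂, x ≤ y := by
  induction l₁ with
  | nil => simp
  | cons a l₁ ih =>
    simp only [List.cons_append, WordAvoids231, List.pairwise_append, List.pairwise_cons] at h
    intro x hx y hy
    rcases List.mem_cons.1 hx with rfl | hx
    · have := h.1.2.1.1 y hy
      have := h₁ x (by simp)
      omega
    · exact ih h.2 (fun x hx => h₁ x (by simp [hx])) x hx y hy

/-- Sorting the two blocks separately already sorts their concatenation, so the sorted blocks are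
consecutive pieces of `List.range' s n`, cut at `l₁.length`. -/
theorem perm_range'_of_append {l₁ l₂ : List ℕ} {s n : ℕ}
    (h : (l₁ ++ l₂).Perm (List.range' s n)) (hlt : ∀ x ∈ l₁, ∀ y ∈ l₂, x ≤ y) :
    l₁.Perm (List.range' s l₁.length) ∧ l₂.Perm (List.range' (s + l₁.length) l₂.length) := by
  have hlen : l₁.length + l₂.length = n := by simpa using h.length_eq
  have p₁ := List.mergeSort_perm l₁ (fun a b => decide (a ≤ b))
  have p₂ := List.mergeSort_perm l₂ (fun a b => decide (a ≤ b))
  have key : l₁.mergeSort (fun a b => decide (a ≤ b)) ++ l₂.mergeSort (fun a b => decide (a ≤ b))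
      = List.range' s l₁.length ++ List.range' (s + l₁.length) l₂.length := by
    have hr : List.range' s l₁.length ++ List.range' (s + l₁.length) l₂.length
        = List.range' s n := by
      rw [← hlen, ← List.range'_append_1]
    rw [hr]
    refine List.Perm.eq_of_pairwise (le := (· ≤ ·)) (fun a b _ _ h1 h2 => le_antisymm h1 h2)
      ?_ ?_ ((p₁.append p₂).trans h)
    · rw [List.pairwise_append]
      refine ⟨?_, ?_, fun x hx y hy => hlt x (p₁.mem_iff.1 hx) y (p₂.mem_iff.1 hy)⟩
      · simpa using List.pairwise_mergeSort (le := fun a b : ℕ => decide (a ≤ b))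
          (by simp; omega) (by simp; omega) l₁
      · simpa using List.pairwise_mergeSort (le := fun a b : ℕ => decide (a ≤ b))
          (by simp; omega) (by simp; omega) l₂
    · exact (List.pairwise_lt_range' (s := s) (n := n)).imp le_of_lt
  obtain ⟨k₁, k₂⟩ := List.append_inj key (by simp)
  exact ⟨k₁ ▸ p₁.symm, k₂ ▸ p₂.symm⟩

theorem range'_append_range' (s i j : ℕ) :
    (List.range' s i ++ List.range' (s + i) j) = List.range' s (i + j) :=
  List.range'_append_1 ..

/-- Splitting a word at its largest letter. -/
theorem sum_words_succ_max {M : Type*} [AddCommMonoid M] (F : List ℕ → M) (s n : ℕ) :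
    ∑ l ∈ words s (n + 1), F l = ∑ p ∈ Finset.HasAntidiagonal.antidiagonal n,
      ∑ u ∈ words s p.1, ∑ v ∈ words (s + p.1) p.2, F (u ++ (s + n) :: v) := by
  simp_rw [← Finset.sum_product']
  rw [Finset.sum_sigma', eq_comm]
  refine Finset.sum_bij (fun x _ => x.2.1 ++ (s + n) :: x.2.2) ?_ ?_ ?_ (fun _ _ => rfl)
  · rintro ⟨⟨i, j⟩, u, v⟩ h
    simp only [Finset.mem_sigma, Finset.HasAntidiagonal.mem_antidiagonal, Finset.mem_product] at h
    obtain ⟨rfl, hu, hv⟩ := h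
    have hum : ∀ x ∈ u, x < s + i := fun x hx => ((mem_of_mem_words hu).1 hx).2
    have hvm : ∀ x ∈ v, s + i ≤ x ∧ x < s + i + j := fun x hx => (mem_of_mem_words hv).1 hx
    refine mem_words.2 ⟨?_, ?_⟩
    · refine List.perm_middle.trans ?_
      rw [List.range'_1_concat, ← range'_append_range']
      refine (List.Perm.cons _ ((mem_words.1 hu).1.append (mem_words.1 hv).1)).trans ?_
      exact (List.perm_append_singleton _ _).symm
    · rw [wordAvoids231_append, wordAvoids231_cons_of_lt]
      · exact ⟨(mem_words.1 hu).2, (mem_words.1 hv).2⟩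
      · intro x hx
        have := hvm x hx
        omega
      · intro x hx y hy
        have := hum x hx
        rcases List.mem_cons.1 hy with rfl | hy
        · omega
        · have := hvm y hy
          omega
  · rintro ⟨⟨i, j⟩, u, v⟩ h ⟨⟨i', j'⟩, u', v'⟩ h' heq
    simp only [Finset.mem_sigma, Finset.HasAntidiagonal.mem_antidiagonal, Finset.mem_product] at h h' heq
    obtain ⟨hij, hu, hv⟩ := h
    obtain ⟨hij', hu', hv'⟩ := h'
    have h1 : s + n ∉ u := fun hx => by have := (mem_of_mem_words hu).1 hx; omega
    have h2 : s + n ∉ u' := fun hx => by have := (mem_of_mem_words hu').1 hx; omega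
    -- The maximal letter occurs in neither `u` nor `u'`, so its position determines the splitting.
    have h3 : u = u' ∧ v = v' := by
      rw [List.append_eq_append_iff] at heq
      rcases heq with ⟨w, hw, hw'⟩ | ⟨w, hw, hw'⟩ <;> rcases w with _ | ⟨c, w⟩ <;> simp_all
    obtain ⟨rfl, rfl⟩ := h3
    have := length_of_mem_words hu
    have := length_of_mem_words hu'
    have := length_of_mem_words hv
    have := length_of_mem_words hv'
    subst_vars
    rfl
  · intro l hl
    have hmem : s + n ∈ l := (mem_of_mem_words hl).2 (by omega)
    obtain ⟨hp, ha⟩ := mem_words.1 hl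
    obtain ⟨u, v, rfl⟩ := List.append_of_mem hmem
    have hp' : (u ++ v).Perm (List.range' s n) := by
      rw [List.range'_1_concat] at hp
      have := List.perm_middle.symm.trans (hp.trans (List.perm_append_singleton _ _))
      exact List.Perm.cons_inv this
    have hm : ∀ x ∈ u ++ v, x < s + n := fun x hx => by
      have := hp'.mem_iff.1 hx
      rw [List.mem_range'_1] at this
      omega
    have hu : ∀ x ∈ u, x < s + n := fun x hx => hm x (by simp [hx])
    have hv : ∀ x ∈ v, x < s + n := fun x hx => hm x (by simp [hx])
    have hle := ha.le_of_append_cons hu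
    have hnd : (u ++ v).Nodup := hp'.nodup_iff.2 List.nodup_range'
    have hlt : ∀ x ∈ u, ∀ y ∈ v, x < y := fun x hx y hy =>
      lt_of_le_of_ne (hle x hx y hy) (List.nodup_append.1 hnd |>.2.2 x hx y hy)
    obtain ⟨h1, h2⟩ := perm_range'_of_append hp' hle
    rw [wordAvoids231_append, wordAvoids231_cons_of_lt hv] at ha
    · refine ⟨⟨(u.length, v.length), u, v⟩, ?_, rfl⟩
      simp only [Finset.mem_sigma, Finset.HasAntidiagonal.mem_antidiagonal, Finset.mem_product]
      exact ⟨by simpa using hp'.length_eq, mem_words.2 ⟨h1, ha.1⟩, mem_words.2 ⟨h2, ha.2⟩⟩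
    · intro x hx y hy
      rcases List.mem_cons.1 hy with rfl | hy
      exacts [hu x hx, hlt x hx y hy]

/-- After a letter above `a`, no letter below `a` can follow without creating a `231` with first
letter `a`. Hence the letters below `a` form a prefix. -/
theorem exists_append_of_pairwise {a : ℕ} {l : List ℕ}
    (h : l.Pairwise fun y z => ¬ (z < a ∧ a < y)) (ha : a ∉ l) :
    ∃ u v, l = u ++ v ∧ (∀ x ∈ u, x < a) ∧ ∀ x ∈ v, a < x := by
  induction l with
  | nil => exact ⟨[], [], by simp⟩
  | cons b l ih =>
    rw [List.pairwise_cons] at h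
    rw [List.mem_cons, not_or] at ha
    rcases lt_or_gt_of_ne ha.1 with hb | hb
    · refine ⟨[], b :: l, by simp, by simp, ?_⟩
      intro x hx
      rcases List.mem_cons.1 hx with rfl | hx
      · exact hb
      · have := h.1 x hx
        have : a ≠ x := fun e => ha.2 (e ▸ hx)
        omega
    · obtain ⟨u, v, rfl, hu, hv⟩ := ih h.2 ha.2
      exact ⟨b :: u, v, by simp, by simpa [hb] using hu, hv⟩

/-- Splitting off the first letter of a word. -/
theorem sum_words_succ_first {M : Type*} [AddCommMonoid M] (F : List ℕ → M) (s n : ℕ) :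
    ∑ l ∈ words s (n + 1), F l = ∑ p ∈ Finset.HasAntidiagonal.antidiagonal n,
      ∑ u ∈ words s p.1, ∑ v ∈ words (s + p.1 + 1) p.2, F ((s + p.1) :: (u ++ v)) := by
  simp_rw [← Finset.sum_product']
  rw [Finset.sum_sigma', eq_comm]
  refine Finset.sum_bij (fun x _ => (s + x.1.1) :: (x.2.1 ++ x.2.2)) ?_ ?_ ?_ (fun _ _ => rfl)
  · rintro ⟨⟨i, j⟩, u, v⟩ h
    simp only [Finset.mem_sigma, Finset.HasAntidiagonal.mem_antidiagonal, Finset.mem_product] at h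
    obtain ⟨rfl, hu, hv⟩ := h
    have hum : ∀ x ∈ u, x < s + i := fun x hx => ((mem_of_mem_words hu).1 hx).2
    have hvm : ∀ x ∈ v, s + i < x := fun x hx => by
      have := (mem_of_mem_words hv).1 hx
      omega
    refine mem_words.2 ⟨?_, ?_, ?_⟩
    · refine List.perm_middle.symm.trans ?_
      rw [show i + j + 1 = i + (j + 1) by ring, ← range'_append_range', List.range'_succ]
      exact (mem_words.1 hu).1.append ((mem_words.1 hv).1.cons _)
    · dsimp only
      refine List.pairwise_append.2 ⟨?_, ?_, ?_⟩
      · exact pairwise_of_forall_mem fun y hy z _ => by have := hum y hy; omega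
      · exact pairwise_of_forall_mem fun y _ z hz => by have := hvm z hz; omega
      · exact fun y hy z _ => by have := hum y hy; omega
    · exact (wordAvoids231_append fun x hx y hy => (hum x hx).trans (hvm y hy)).2
        ⟨(mem_words.1 hu).2, (mem_words.1 hv).2⟩
  · rintro ⟨⟨i, j⟩, u, v⟩ h ⟨⟨i', j'⟩, u', v'⟩ h' heq
    simp only [Finset.mem_sigma, Finset.HasAntidiagonal.mem_antidiagonal, Finset.mem_product] at h h' heq
    obtain ⟨hij, hu, hv⟩ := h
    obtain ⟨hij', hu', hv'⟩ := h'
    obtain ⟨e1, e2⟩ := List.cons.inj heq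
    obtain rfl : i = i' := by omega
    obtain rfl : j = j' := by omega
    obtain ⟨rfl, rfl⟩ := List.append_inj e2
      ((length_of_mem_words hu).trans (length_of_mem_words hu').symm)
    rfl
  · intro l hl
    obtain ⟨hp, ha⟩ := mem_words.1 hl
    rcases l with _ | ⟨a, l⟩
    · simp at hp
    have hnd : (a :: l).Nodup := hp.nodup_iff.2 List.nodup_range'
    obtain ⟨u, v, rfl, hu, hv⟩ := exists_append_of_pairwise ha.1 (List.nodup_cons.1 hnd).1
    have hp' : (u ++ a :: v).Perm (List.range' s (n + 1)) := List.perm_middle.trans hp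
    obtain ⟨h1, h2⟩ := perm_range'_of_append hp' (by
      intro x hx y hy
      have := hu x hx
      rcases List.mem_cons.1 hy with rfl | hy
      · omega
      · have := hv y hy
        omega)
    have hlen : u.length + v.length = n := by
      have := hp.length_eq
      simp at this
      omega
    -- Cutting the upper block `a :: v` once more, after its least letter `a`, identifies `a` as `s
    -- + u.length`.
    have h2' := perm_range'_of_append (l₁ := [a]) h2 (by
      intro x hx y hy
      rw [List.mem_singleton.1 hx]
      exact (hv y hy).le)
    have hav : a = s + u.length := by simpa using h2'.1
    have ha' := ha.2
    rw [wordAvoids231_append fun x hx y hy => (hu x hx).trans (hv y hy)] at ha'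
    refine ⟨⟨(u.length, v.length), u, v⟩, ?_, by simp [hav]⟩
    simp only [Finset.mem_sigma, Finset.HasAntidiagonal.mem_antidiagonal, Finset.mem_product]
    exact ⟨hlen, mem_words.2 ⟨h1, ha'.1⟩, mem_words.2 ⟨h2'.2, ha'.2⟩⟩

end Words

/-! ### The functional equation and the recursions that imply it -/

section FunctionalEquation

open PowerSeries

variable {R : Type*} [CommRing R]

theorem rescale_C_eq (q a : R) : rescale q (C a) = C a := by
  ext n
  by_cases h : n = 0 <;> simp [h, coeff_C]

/-- Each partial numerator carries exactly one factor `z`, so scaling all of them by `q` amounts to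
replacing `z` by `q z`. By induction both sides are inverses of the same denominator. -/
theorem convergent_mul_left (q : R) (N : ℕ) (c : ℕ → R) :
    convergent N (fun k => q * c k) = rescale q (convergent N c) := by
  induction N generalizing c with
  | zero => simp [convergent]
  | succ N ih =>
    have h1 := denom_mul_inv (q * c 0) (convergent N fun k => q * c (k + 1))
    have h2 := congrArg (rescale q) (denom_mul_inv (c 0) (convergent N fun k => c (k + 1)))
    change _ * convergent (N + 1) (fun k => q * c k) = 1 at h1
    change rescale q (_ * convergent (N + 1) c) = _ at h2
    simp only [map_mul, map_sub, map_one, rescale_X, rescale_C_eq, ← ih] at h1 h2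
    linear_combination rescale q (convergent (N + 1) c) * h1
      - convergent (N + 1) (fun k => q * c k) * h2

theorem stieltjesCF_mul_left (q : R) (c : ℕ → R) :
    stieltjesCF (fun k => q * c k) = rescale q (stieltjesCF c) := by
  ext n
  simp only [stieltjesCF, coeff_mk, convergent_mul_left, coeff_rescale]

/-- The functional equation of the generating function of the `(q,t)`-Catalan numbers. -/
def IsCatalanSeries (t q : R) (F : R⟦X⟧) : Prop :=
  F = 1 + X * (F + C t * (rescale q F * (F - 1)))

theorem isCatalanSeries_stieltjesCF (t q : R) :
    IsCatalanSeries t q (stieltjesCF (catCoeff t q)) := by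
  have h1 := stieltjesCF_unfold (catCoeff t q)
  have h2 := stieltjesCF_unfold (fun k => catCoeff t q (k + 1))
  have h3 : (fun k => catCoeff t q (k + 1 + 1)) = fun k => q * catCoeff t q k := by
    ext k
    have : (k + 1 + 1) / 2 = k / 2 + 1 := by omega
    simp only [catCoeff, Nat.even_add_one, not_not, this]
    split <;> ring
  simp only [h3, stieltjesCF_mul_left] at h2
  have h4 : catCoeff t q 0 = 1 := by simp [catCoeff]
  have h5 : catCoeff t q (0 + 1) = t := by simp [catCoeff]
  rw [h4, map_one, one_mul] at h1
  rw [h5] at h2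
  unfold IsCatalanSeries
  -- With `G` the once-shifted fraction, `h1` says `(1 - X G) F = 1` and `h2` says `(1 - t X F(qz))
  -- G = 1`; this combination eliminates `G`.
  linear_combination (1 - C t * X * rescale q (stieltjesCF (catCoeff t q))) * h1
    + X * stieltjesCF (catCoeff t q) * h2

/-- Because of the outer factor `X`, the coefficient of index `k + 1` depends only on coefficients
of index at most `k`. -/
theorem IsCatalanSeries.unique {t q : R} {F G : R⟦X⟧} (hF : IsCatalanSeries t q F)
    (hG : IsCatalanSeries t q G) : F = G := by
  have key : ∀ n, ∀ k < n, coeff k F = coeff k G := by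
    intro n
    induction n with
    | zero => simp
    | succ n ih =>
      intro k hk
      rcases k with _ | k
      · rw [hF, hG]
        simp
      · have hs : ∀ {A B A' B' : R⟦X⟧}, (∀ i ≤ k, coeff i A = coeff i A') →
            (∀ i ≤ k, coeff i B = coeff i B') → coeff k (A * B) = coeff k (A' * B') := by
          intro A B A' B' hA hB
          rw [coeff_mul, coeff_mul]
          refine Finset.sum_congr rfl fun p hp => ?_
          have := Finset.HasAntidiagonal.mem_antidiagonal.1 hp
          rw [hA _ (by omega), hB _ (by omega)]
        rw [hF, hG]
        simp only [map_add, coeff_succ_X_mul, coeff_C_mul]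
        rw [ih k (by omega), hs (A' := rescale q G) (B' := G - 1)]
        · intro i hi
          rw [coeff_rescale, coeff_rescale, ih i (by omega)]
        · intro i hi
          rw [map_sub, map_sub, ih i (by omega)]
  ext n
  exact key (n + 1) n (by omega)

theorem qtCatalan_eq_coeff {t q : R} {F : R⟦X⟧} (hF : IsCatalanSeries t q F) (n : ℕ) :
    qtCatalan n t q = coeff n F := by
  rw [qtCatalan, (isCatalanSeries_stieltjesCF t q).unique hF]

theorem eq_one_add_X_mul {f : ℕ → R} {F : R⟦X⟧} (h0 : f 0 = 1)
    (hs : ∀ n, f (n + 1) = coeff n F) : mk f = 1 + X * F := by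
  ext n
  rcases n with _ | n
  · simp [h0]
  · simp [coeff_succ_X_mul, hs, coeff_one]

theorem coeff_mk_mul_mk (f g : ℕ → R) (n : ℕ) :
    coeff n (mk f * mk g) = ∑ p ∈ Finset.HasAntidiagonal.antidiagonal n, f p.1 * g p.2 := by
  simp [coeff_mul]

theorem mk_weighted {t : R} {f : ℕ → R} (h0 : f 0 = 1) :
    mk (fun n => (if n = 0 then 1 else t) * f n) = 1 + C t * (mk f - 1) := by
  ext n
  by_cases h : n = 0 <;> simp [h, h0, coeff_one]

/-- The terms with `p.1 = 0` sum to `F`, the others to `t (F - 1) F(qz)`. -/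
theorem qtCatalan_eq_of_max_asc {t q : R} {f : ℕ → R} (h0 : f 0 = 1)
    (hs : ∀ n, f (n + 1) = ∑ p ∈ Finset.HasAntidiagonal.antidiagonal n,
      (if p.1 = 0 then 1 else t * q ^ p.2) * (f p.1 * f p.2)) (n : ℕ) :
    qtCatalan n t q = f n := by
  have h : IsCatalanSeries t q (mk f) := by
    refine eq_one_add_X_mul h0 fun n => ?_
    -- Writing `F` as the product `1 * F` turns it into a sum over the same antidiagonal, supported
    -- at `p.1 = 0`.
    have e1 : mk f = 1 * mk f := (one_mul _).symm
    rw [map_add, coeff_C_mul, mul_comm (rescale q (mk f))]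
    conv_rhs => enter [1]; rw [e1]
    rw [coeff_mul, coeff_mul, Finset.mul_sum, ← Finset.sum_add_distrib, hs]
    refine Finset.sum_congr rfl fun p _ => ?_
    by_cases hp : p.1 = 0
    · simp [hp, h0, coeff_one]
    · simp [hp, coeff_one]
      ring
  rw [qtCatalan_eq_coeff h, coeff_mk]

theorem qtCatalan_eq_of_max_des {t q : R} {f : ℕ → R} (h0 : f 0 = 1)
    (hs : ∀ n, f (n + 1) = ∑ p ∈ Finset.HasAntidiagonal.antidiagonal n,
      (if p.2 = 0 then 1 else t) * (if p.1 = 0 then 1 else q ^ p.2) * (f p.1 * f p.2)) (n : ℕ) :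
    qtCatalan n t q = f n := by
  have h : IsCatalanSeries t q (mk f) := by
    -- The two summands collect the terms with `p.1 = 0` and with `p.1 > 0`; a factor `1 + t (H -
    -- 1)` puts the weight `t` exactly on `p.2 > 0`.
    have hr : mk f + C t * (rescale q (mk f) * (mk f - 1)) =
        1 * (1 + C t * (mk f - 1)) + (mk f - 1) * (1 + C t * (rescale q (mk f) - 1)) := by ring
    have hc : constantCoeff (rescale q (mk f)) = 1 := by
      rw [← coeff_zero_eq_constantCoeff_apply]
      simp [h0]
    refine eq_one_add_X_mul h0 fun n => ?_
    rw [hr, map_add, coeff_mul, coeff_mul, ← Finset.sum_add_distrib, hs]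
    refine Finset.sum_congr rfl fun p _ => ?_
    by_cases hp : p.1 = 0 <;> by_cases hp2 : p.2 = 0 <;> (simp [hp, hp2, h0, hc, coeff_one]; try ring)
  rw [qtCatalan_eq_coeff h, coeff_mk]

theorem mk_pow_mul (q : R) (f : ℕ → R) : mk (fun n => q ^ n * f n) = rescale q (mk f) := by
  ext n
  simp

/-- Here `g` will count words preceded by a letter larger than all of theirs. The recursions say `F
= 1 + z G F` and `G = 1 + t z G F(qz)`, which is the twice-unfolded continued fraction. -/
theorem qtCatalan_eq_of_first_des {t q : R} {f g : ℕ → R} (hf0 : f 0 = 1) (hg0 : g 0 = 1)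
    (hf : ∀ n, f (n + 1) = ∑ p ∈ Finset.HasAntidiagonal.antidiagonal n, g p.1 * f p.2)
    (hg : ∀ n, g (n + 1) = t * ∑ p ∈ Finset.HasAntidiagonal.antidiagonal n, g p.1 * (q ^ p.2 * f p.2)) (n : ℕ) :
    qtCatalan n t q = f n := by
  have h1 := eq_one_add_X_mul (F := mk g * mk f) hf0 fun n => by rw [hf, coeff_mk_mul_mk]
  have h2 := eq_one_add_X_mul (F := C t * (mk g * rescale q (mk f))) hg0 fun n => by
    rw [hg, coeff_C_mul, ← mk_pow_mul, coeff_mk_mul_mk]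
  have h : IsCatalanSeries t q (mk f) := by
    unfold IsCatalanSeries
    linear_combination (1 - C t * X * rescale q (mk f)) * h1 + X * mk f * h2
  rw [qtCatalan_eq_coeff h, coeff_mk]

/-- With `H = 1 + t (F - 1)` the recursions read `F = 1 + z G H` and `G = 1 + z G H(qz)`.
Eliminating `G` gives the same functional equation, although the auxiliary series differs from that
of the continued fraction. -/
theorem qtCatalan_eq_of_first_asc {t q : R} {f g : ℕ → R} (hf0 : f 0 = 1) (hg0 : g 0 = 1)
    (hf : ∀ n, f (n + 1) =
      ∑ p ∈ Finset.HasAntidiagonal.antidiagonal n, g p.1 * ((if p.2 = 0 then 1 else t) * f p.2))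
    (hg : ∀ n, g (n + 1) =
      ∑ p ∈ Finset.HasAntidiagonal.antidiagonal n, g p.1 * (q ^ p.2 * ((if p.2 = 0 then 1 else t) * f p.2)))
    (n : ℕ) :
    qtCatalan n t q = f n := by
  have h1 := eq_one_add_X_mul (F := mk g * (1 + C t * (mk f - 1))) hf0 fun n => by
    rw [hf, ← mk_weighted hf0, coeff_mk_mul_mk]
  have h2 := eq_one_add_X_mul (F := mk g * (1 + C t * (rescale q (mk f) - 1))) hg0 fun n => by
    have : 1 + C t * (rescale q (mk f) - 1) = rescale q (1 + C t * (mk f - 1)) := by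
      simp [rescale_C_eq]
    rw [hg, this, ← mk_weighted hf0, ← mk_pow_mul, coeff_mk_mul_mk]
  have h : IsCatalanSeries t q (mk f) := by
    unfold IsCatalanSeries
    linear_combination (1 - X * (1 + C t * (rescale q (mk f) - 1))) * h1
      + X * (1 + C t * (mk f - 1)) * h2
  rw [qtCatalan_eq_coeff h, coeff_mk]

end FunctionalEquation

/-! ### Behaviour of the statistics under the two decompositions -/

section WordStatistics

/-- The number of pairs of consecutive letters related by `r`. -/
def consecCount (r : ℕ → ℕ → Prop) [DecidableRel r] : List ℕ → ℕ
  | [] => 0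
  | [_] => 0
  | x :: y :: l => (if r x y then 1 else 0) + consecCount r (y :: l)

/-- The number of occurrences of a pair of consecutive letters and a later letter
that satisfy `P`. -/
def vincCount (P : ℕ → ℕ → ℕ → Prop) [∀ x y, DecidablePred (P x y)] : List ℕ → ℕ
  | [] => 0
  | [_] => 0
  | x :: y :: l => l.countP (P x y) + vincCount P (y :: l)

/-- Descents of a word. -/
abbrev wordDes : List ℕ → ℕ := consecCount fun x y => y < x

/-- Ascents of a word. -/
abbrev wordAsc : List ℕ → ℕ := consecCount fun x y => x < y

/-- Occurrences of `31-2` in a word. -/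
abbrev word31_2 : List ℕ → ℕ := vincCount fun x y z => y < z ∧ z < x

/-- Occurrences of `13-2` in a word. -/
abbrev word13_2 : List ℕ → ℕ := vincCount fun x y z => x < z ∧ z < y

theorem countP_eq_zero_of_forall {p : ℕ → Prop} [DecidablePred p] {l : List ℕ}
    (h : ∀ x ∈ l, ¬ p x) : l.countP p = 0 := by
  simpa [List.countP_eq_zero] using h

theorem countP_eq_length_of_forall {p : ℕ → Prop} [DecidablePred p] {l : List ℕ}
    (h : ∀ x ∈ l, p x) : l.countP p = l.length := by
  simpa [List.countP_eq_length] using h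

variable {m : ℕ} {u v : List ℕ}

theorem wordDes_append_max (hu : ∀ x ∈ u, x < m) (hv : ∀ x ∈ v, x < m) :
    wordDes (u ++ m :: v) = wordDes u + wordDes v + if v = [] then 0 else 1 := by
  induction u with
  | nil => rcases v with _ | ⟨y, v⟩ <;> simp_all [wordDes, consecCount]; omega
  | cons a u ih =>
    specialize ih fun x hx => hu x (by simp [hx])
    have := hu a (by simp)
    rcases u with _ | ⟨b, u⟩ <;> simp_all [wordDes, consecCount] <;> omega

theorem wordAsc_append_max (hu : ∀ x ∈ u, x < m) (hv : ∀ x ∈ v, x < m) :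
    wordAsc (u ++ m :: v) = wordAsc u + wordAsc v + if u = [] then 0 else 1 := by
  induction u with
  | nil => rcases v with _ | ⟨y, v⟩ <;> simp_all [wordAsc, consecCount]; omega
  | cons a u ih =>
    specialize ih fun x hx => hu x (by simp [hx])
    have := hu a (by simp)
    rcases u with _ | ⟨b, u⟩ <;> simp_all [wordAsc, consecCount] <;> omega

/-- The new occurrences are the last letter of `u`, then `m`, then any letter of `v`. Two adjacent
letters of `u` lie below everything in `m :: v`, and a pair starting with `m` is a descent. -/
theorem word13_2_append_max (hu : ∀ x ∈ u, x < m) (hv : ∀ x ∈ v, x < m)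
    (huv : ∀ x ∈ u, ∀ y ∈ v, x < y) :
    word13_2 (u ++ m :: v) = word13_2 u + word13_2 v + if u = [] then 0 else v.length := by
  have h0 : word13_2 (m :: v) = word13_2 v := by
    rcases v with _ | ⟨y, v⟩
    · rfl
    · simp only [word13_2, vincCount]
      rw [countP_eq_zero_of_forall fun z hz => ?_, zero_add]
      have := hv z (by simp [hz])
      omega
  induction u with
  | nil => simpa [vincCount] using h0
  | cons a u ih =>
    specialize ih (fun x hx => hu x (by simp [hx])) (fun x hx => huv x (by simp [hx]))
    have ha := hu a (by simp)
    rcases u with _ | ⟨b, u⟩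
    · have : v.countP (fun z => a < z ∧ z < m) = v.length :=
        countP_eq_length_of_forall fun z hz => ⟨huv a (by simp) z hz, hv z hz⟩
      simp only [List.cons_append, List.nil_append, word13_2, vincCount, this, if_true,
        reduceCtorEq, if_false] at ih ⊢
      omega
    · have hb := hu b (by simp)
      have : (m :: v).countP (fun z => a < z ∧ z < b) = 0 :=
        countP_eq_zero_of_forall fun z hz => by
          rcases List.mem_cons.1 hz with rfl | hz
          · omega
          · have := huv b (by simp) z hz
            omega
      simp only [List.cons_append, word13_2, vincCount, List.countP_append, this] at ih ⊢
      simp only [reduceCtorEq, if_false] at ih ⊢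
      omega

theorem wordDes_append (huv : ∀ x ∈ u, ∀ y ∈ v, x < y) :
    wordDes (u ++ v) = wordDes u + wordDes v := by
  induction u with
  | nil => simp [consecCount]
  | cons a u ih =>
    specialize ih (fun x hx => huv x (by simp [hx]))
    rcases u with _ | ⟨b, u⟩
    · rcases v with _ | ⟨c, v⟩
      · rfl
      · have := huv a (by simp) c (by simp)
        simp [consecCount]
        omega
    · simp only [List.cons_append, wordDes, consecCount] at ih ⊢
      omega

theorem wordAsc_append (hu : u ≠ []) (huv : ∀ x ∈ u, ∀ y ∈ v, x < y) :
    wordAsc (u ++ v) = wordAsc u + wordAsc v + if v = [] then 0 else 1 := by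
  induction u with
  | nil => exact absurd rfl hu
  | cons a u ih =>
    rcases u with _ | ⟨b, u⟩
    · rcases v with _ | ⟨c, v⟩
      · rfl
      · have := huv a (by simp) c (by simp)
        simp [consecCount, this, add_comm]
    · specialize ih (by simp) (fun x hx => huv x (by simp [hx]))
      simp only [List.cons_append, wordAsc, consecCount] at ih ⊢
      omega

/-- The step from `u` to `v` is an ascent, and no letter of `v` lies between two letters of `u`. -/
theorem word31_2_append (huv : ∀ x ∈ u, ∀ y ∈ v, x < y) :
    word31_2 (u ++ v) = word31_2 u + word31_2 v := by
  induction u with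
  | nil => simp [vincCount]
  | cons a u ih =>
    specialize ih (fun x hx => huv x (by simp [hx]))
    rcases u with _ | ⟨b, u⟩
    · rcases v with _ | ⟨c, v⟩
      · rfl
      · have := huv a (by simp) c (by simp)
        have : v.countP (fun z => c < z ∧ z < a) = 0 :=
          countP_eq_zero_of_forall fun z hz => by omega
        simp only [List.cons_append, List.nil_append, word31_2, vincCount, this]
    · have : v.countP (fun z => b < z ∧ z < a) = 0 :=
        countP_eq_zero_of_forall fun z hz => by
          have := huv a (by simp) z hz
          omega
      simp only [List.cons_append, word31_2, vincCount, List.countP_append, this] at ih ⊢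
      omega

/-- The initial descent `c a` plays the role of `31`, and the letters that can serve as `2` are
exactly those of `v`. -/
theorem word31_2_cons_cons {a c : ℕ} (hu : ∀ x ∈ u, x < a) (hv : ∀ x ∈ v, a < x ∧ x < c) :
    word31_2 (c :: a :: (u ++ v)) = v.length + word31_2 (a :: (u ++ v)) := by
  have h1 : u.countP (fun z => a < z ∧ z < c) = 0 :=
    countP_eq_zero_of_forall fun z hz => by
      have := hu z hz
      omega
  have h2 : v.countP (fun z => a < z ∧ z < c) = v.length := countP_eq_length_of_forall hv
  simp only [word31_2, vincCount, List.countP_append, h1, h2, zero_add]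

end WordStatistics

/-! ### Recursions for the weighted sums over words -/

section WordSums

variable {R : Type*} [CommRing R] (t q : R)

/-- The decomposition moves the second block to a shifted alphabet; independence of `s` closes the
recursion at `s = 0`. -/
theorem shift_invariant_of_max {F : ℕ → ℕ → R} {c : ℕ × ℕ → R} (h0 : ∀ s, F s 0 = 1)
    (hs : ∀ s n, F s (n + 1) = ∑ p ∈ Finset.HasAntidiagonal.antidiagonal n,
      c p * (F s p.1 * F (s + p.1) p.2)) (s n : ℕ) : F s n = F 0 n := by
  induction n using Nat.strong_induction_on generalizing s with
  | _ n ih =>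
    rcases n with _ | n
    · rw [h0, h0]
    · rw [hs, hs]
      refine Finset.sum_congr rfl fun p hp => ?_
      have := Finset.HasAntidiagonal.mem_antidiagonal.1 hp
      rw [ih p.1 (by omega) s, ih p.2 (by omega) (s + p.1), ih p.2 (by omega) (0 + p.1)]

theorem sum_words_max_eq {c : ℕ × ℕ → R} {wt : List ℕ → R}
    (hwt : ∀ (s i j : ℕ), ∀ u ∈ words s i, ∀ v ∈ words (s + i) j,
      wt (u ++ (s + (i + j)) :: v) = c (i, j) * (wt u * wt v)) (h0 : wt [] = 1) (n : ℕ) :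
    ∑ l ∈ words 0 (n + 1), wt l = ∑ p ∈ Finset.HasAntidiagonal.antidiagonal n,
      c p * ((∑ l ∈ words 0 p.1, wt l) * ∑ l ∈ words 0 p.2, wt l) := by
  have hs : ∀ s n, ∑ l ∈ words s (n + 1), wt l = ∑ p ∈ Finset.HasAntidiagonal.antidiagonal n,
      c p * ((∑ l ∈ words s p.1, wt l) * ∑ l ∈ words (s + p.1) p.2, wt l) := by
    intro s n
    rw [sum_words_succ_max]
    refine Finset.sum_congr rfl fun p hp => ?_
    rw [Finset.sum_mul_sum, Finset.mul_sum]
    refine Finset.sum_congr rfl fun u hu => ?_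
    rw [Finset.mul_sum]
    refine Finset.sum_congr rfl fun v hv => ?_
    rw [← hwt s p.1 p.2 u hu v hv, Finset.HasAntidiagonal.mem_antidiagonal.1 hp]
  rw [hs]
  refine Finset.sum_congr rfl fun p _ => ?_
  rw [shift_invariant_of_max (F := fun s n => ∑ l ∈ words s n, wt l)
    (fun s => by simp [words_zero, h0]) hs (0 + p.1)]

theorem shift_invariant_of_first {F G : ℕ → ℕ → R} {c d : ℕ × ℕ → R} (hF0 : ∀ s, F s 0 = 1)
    (hG0 : ∀ s, G s 0 = 1)
    (hF : ∀ s n, F s (n + 1) = ∑ p ∈ Finset.HasAntidiagonal.antidiagonal n,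
      c p * (G s p.1 * F (s + p.1 + 1) p.2))
    (hG : ∀ s n, G s (n + 1) = ∑ p ∈ Finset.HasAntidiagonal.antidiagonal n,
      d p * (G s p.1 * F (s + p.1 + 1) p.2)) (s n : ℕ) : F s n = F 0 n ∧ G s n = G 0 n := by
  induction n using Nat.strong_induction_on generalizing s with
  | _ n ih =>
    rcases n with _ | n
    · simp only [hF0, hG0, and_self]
    · rw [hF, hF, hG, hG]
      constructor <;> refine Finset.sum_congr rfl fun p hp => ?_ <;>
        have := Finset.HasAntidiagonal.mem_antidiagonal.1 hp <;>
        rw [(ih p.1 (by omega) s).2, (ih p.2 (by omega) (s + p.1 + 1)).1,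
          (ih p.2 (by omega) (0 + p.1 + 1)).1]

/-- Removing the first letter `a` of `a u v` would lose the pair formed by `a` and the first letter
of `u`, so the left factor keeps `a` as a maximal letter in front of `u`. This forces a second sum,
over words with a larger letter in front; `c` and `d` are the factors for the plain and the prefixed
words. -/
theorem sum_words_first_eq {c d : ℕ × ℕ → R} {wt : List ℕ → R}
    (hc : ∀ (s i j : ℕ), ∀ u ∈ words s i, ∀ v ∈ words (s + i + 1) j,
      wt ((s + i) :: (u ++ v)) = c (i, j) * (wt ((s + i) :: u) * wt v))
    (hd : ∀ (s i j : ℕ), ∀ u ∈ words s i, ∀ v ∈ words (s + i + 1) j,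
      wt ((s + (i + j + 1)) :: (s + i) :: (u ++ v)) = d (i, j) * (wt ((s + i) :: u) * wt v))
    (h0 : wt [] = 1) (h1 : ∀ a, wt [a] = 1) (n : ℕ) :
    (∑ l ∈ words 0 (n + 1), wt l = ∑ p ∈ Finset.HasAntidiagonal.antidiagonal n,
      c p * ((∑ l ∈ words 0 p.1, wt (p.1 :: l)) * ∑ l ∈ words 0 p.2, wt l)) ∧
    (∑ l ∈ words 0 (n + 1), wt ((n + 1) :: l) = ∑ p ∈ Finset.HasAntidiagonal.antidiagonal n,
      d p * ((∑ l ∈ words 0 p.1, wt (p.1 :: l)) * ∑ l ∈ words 0 p.2, wt l)) := by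
  have hF : ∀ s n, ∑ l ∈ words s (n + 1), wt l = ∑ p ∈ Finset.HasAntidiagonal.antidiagonal n,
      c p * ((∑ l ∈ words s p.1, wt ((s + p.1) :: l)) * ∑ l ∈ words (s + p.1 + 1) p.2, wt l) := by
    intro s n
    rw [sum_words_succ_first]
    refine Finset.sum_congr rfl fun p hp => ?_
    rw [Finset.sum_mul_sum, Finset.mul_sum]
    refine Finset.sum_congr rfl fun u hu => ?_
    rw [Finset.mul_sum]
    exact Finset.sum_congr rfl fun v hv => hc s p.1 p.2 u hu v hv
  have hG : ∀ s n, ∑ l ∈ words s (n + 1), wt ((s + (n + 1)) :: l) =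
      ∑ p ∈ Finset.HasAntidiagonal.antidiagonal n, d p *
        ((∑ l ∈ words s p.1, wt ((s + p.1) :: l)) * ∑ l ∈ words (s + p.1 + 1) p.2, wt l) := by
    intro s n
    rw [sum_words_succ_first]
    refine Finset.sum_congr rfl fun p hp => ?_
    rw [Finset.sum_mul_sum, Finset.mul_sum]
    refine Finset.sum_congr rfl fun u hu => ?_
    rw [Finset.mul_sum]
    refine Finset.sum_congr rfl fun v hv => ?_
    rw [← hd s p.1 p.2 u hu v hv, Finset.HasAntidiagonal.mem_antidiagonal.1 hp]
  have hsh := shift_invariant_of_first (F := fun s n => ∑ l ∈ words s n, wt l)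
    (G := fun s n => ∑ l ∈ words s n, wt ((s + n) :: l))
    (fun s => by simp [words_zero, h0]) (fun s => by simp [words_zero, h1]) hF hG
  constructor
  · rw [hF]
    refine Finset.sum_congr rfl fun p _ => ?_
    rw [(hsh (0 + p.1 + 1) p.2).1]
    simp only [zero_add]
  · have := hG 0 n
    simp only [zero_add] at this
    rw [this]
    refine Finset.sum_congr rfl fun p _ => ?_
    have := (hsh (p.1 + 1) p.2).1
    rw [this]

theorem eq_nil_iff_of_mem_words {s n : ℕ} {l : List ℕ} (h : l ∈ words s n) : l = [] ↔ n = 0 := by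
  rw [← List.length_eq_zero_iff, length_of_mem_words h]

theorem lt_of_mem_words_of_mem_words {s i j : ℕ} {u v : List ℕ} (hu : u ∈ words s i)
    (hv : v ∈ words (s + i) j) :
    (∀ x ∈ u, x < s + (i + j)) ∧ (∀ x ∈ v, x < s + (i + j)) ∧ ∀ x ∈ u, ∀ y ∈ v, x < y := by
  have h1 := fun x => (mem_of_mem_words hu (x := x)).1
  have h2 := fun x => (mem_of_mem_words hv (x := x)).1
  refine ⟨fun x hx => ?_, fun x hx => ?_, fun x hx y hy => ?_⟩
  · have := h1 x hx
    have := h1 x hx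
    omega
  · have := h2 x hx
    omega
  · have := h1 x hx
    have := h2 y hy
    omega

theorem lt_of_mem_words_of_mem_words_succ {s i j : ℕ} {u v : List ℕ} (hu : u ∈ words s i)
    (hv : v ∈ words (s + i + 1) j) :
    (∀ x ∈ u, x < s + i) ∧ (∀ x ∈ v, s + i < x ∧ x < s + (i + j + 1)) ∧
      ∀ x ∈ (s + i) :: u, ∀ y ∈ v, x < y := by
  have h1 := fun x => (mem_of_mem_words hu (x := x)).1
  have h2 := fun x => (mem_of_mem_words hv (x := x)).1
  refine ⟨fun x hx => (h1 x hx).2, fun x hx => ?_, fun x hx y hy => ?_⟩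
  · have := h2 x hx
    omega
  · have := h2 y hy
    rcases List.mem_cons.1 hx with rfl | hx
    · omega
    · have := h1 x hx
      omega

theorem qtCatalan_eq_sum_des_13_2 (n : ℕ) :
    qtCatalan n t q = ∑ l ∈ words 0 n, t ^ wordDes l * q ^ word13_2 l := by
  refine qtCatalan_eq_of_max_des (f := fun n => ∑ l ∈ words 0 n, t ^ wordDes l * q ^ word13_2 l)
    (by simp [words_zero, consecCount, vincCount]) (fun n => ?_) n
  refine sum_words_max_eq
    (c := fun p => (if p.2 = 0 then 1 else t) * (if p.1 = 0 then 1 else q ^ p.2)) ?_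
    (by simp [consecCount, vincCount]) n
  intro s i j u hu v hv
  obtain ⟨h1, h2, h3⟩ := lt_of_mem_words_of_mem_words hu hv
  rw [wordDes_append_max h1 h2, word13_2_append_max h1 h2 h3, length_of_mem_words hv]
  simp only [eq_nil_iff_of_mem_words hu, eq_nil_iff_of_mem_words hv]
  split_ifs <;> ring

theorem qtCatalan_eq_sum_asc_13_2 (n : ℕ) :
    qtCatalan n t q = ∑ l ∈ words 0 n, t ^ wordAsc l * q ^ word13_2 l := by
  refine qtCatalan_eq_of_max_asc (f := fun n => ∑ l ∈ words 0 n, t ^ wordAsc l * q ^ word13_2 l)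
    (by simp [words_zero, consecCount, vincCount]) (fun n => ?_) n
  refine sum_words_max_eq (c := fun p => (if p.1 = 0 then 1 else t * q ^ p.2)) ?_
    (by simp [consecCount, vincCount]) n
  intro s i j u hu v hv
  obtain ⟨h1, h2, h3⟩ := lt_of_mem_words_of_mem_words hu hv
  rw [wordAsc_append_max h1 h2, word13_2_append_max h1 h2 h3, length_of_mem_words hv]
  simp only [eq_nil_iff_of_mem_words hu]
  split_ifs <;> ring

theorem qtCatalan_eq_sum_des_31_2 (n : ℕ) :
    qtCatalan n t q = ∑ l ∈ words 0 n, t ^ wordDes l * q ^ word31_2 l := by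
  have key := sum_words_first_eq (wt := fun l => t ^ wordDes l * q ^ word31_2 l)
    (c := fun _ => 1) (d := fun p => t * q ^ p.2) ?_ ?_
    (by simp [consecCount, vincCount]) (by simp [consecCount, vincCount])
  · refine qtCatalan_eq_of_first_des
      (f := fun n => ∑ l ∈ words 0 n, t ^ wordDes l * q ^ word31_2 l)
      (g := fun n => ∑ l ∈ words 0 n, t ^ wordDes (n :: l) * q ^ word31_2 (n :: l))
      (by simp [words_zero, consecCount, vincCount])
      (by simp [words_zero, consecCount, vincCount]) (fun n => ?_) (fun n => ?_) n
    · exact (key n).1.trans (Finset.sum_congr rfl fun p _ => by ring)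
    · rw [Finset.mul_sum]
      exact (key n).2.trans (Finset.sum_congr rfl fun p _ => by ring)
  · intro s i j u hu v hv
    obtain ⟨h1, h2, h3⟩ := lt_of_mem_words_of_mem_words_succ hu hv
    rw [← List.cons_append, wordDes_append h3, word31_2_append h3]
    ring
  · intro s i j u hu v hv
    obtain ⟨h1, h2, h3⟩ := lt_of_mem_words_of_mem_words_succ hu hv
    have hd : wordDes ((s + (i + j + 1)) :: (s + i) :: (u ++ v)) =
        1 + wordDes ((s + i) :: (u ++ v)) := by
      simp only [wordDes, consecCount]
      rw [if_pos (by omega)]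
    rw [word31_2_cons_cons h1 h2, hd, ← List.cons_append, wordDes_append h3, word31_2_append h3,
      length_of_mem_words hv]
    ring

theorem qtCatalan_eq_sum_asc_31_2 (n : ℕ) :
    qtCatalan n t q = ∑ l ∈ words 0 n, t ^ wordAsc l * q ^ word31_2 l := by
  have key := sum_words_first_eq (wt := fun l => t ^ wordAsc l * q ^ word31_2 l)
    (c := fun p => if p.2 = 0 then 1 else t) (d := fun p => q ^ p.2 * if p.2 = 0 then 1 else t)
    ?_ ?_ (by simp [consecCount, vincCount]) (by simp [consecCount, vincCount])
  · refine qtCatalan_eq_of_first_asc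
      (f := fun n => ∑ l ∈ words 0 n, t ^ wordAsc l * q ^ word31_2 l)
      (g := fun n => ∑ l ∈ words 0 n, t ^ wordAsc (n :: l) * q ^ word31_2 (n :: l))
      (by simp [words_zero, consecCount, vincCount])
      (by simp [words_zero, consecCount, vincCount]) (fun n => ?_) (fun n => ?_) n
    · exact (key n).1.trans (Finset.sum_congr rfl fun p _ => by ring)
    · exact (key n).2.trans (Finset.sum_congr rfl fun p _ => by ring)
  · intro s i j u hu v hv
    obtain ⟨h1, h2, h3⟩ := lt_of_mem_words_of_mem_words_succ hu hv
    rw [← List.cons_append, wordAsc_append (by simp) h3, word31_2_append h3]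
    simp only [eq_nil_iff_of_mem_words hv]
    split_ifs <;> ring
  · intro s i j u hu v hv
    obtain ⟨h1, h2, h3⟩ := lt_of_mem_words_of_mem_words_succ hu hv
    have hd : wordAsc ((s + (i + j + 1)) :: (s + i) :: (u ++ v)) =
        wordAsc ((s + i) :: (u ++ v)) := by
      simp only [wordAsc, consecCount]
      rw [if_neg (by omega), zero_add]
    rw [word31_2_cons_cons h1 h2, hd, ← List.cons_append, wordAsc_append (by simp) h3,
      word31_2_append h3, length_of_mem_words hv]
    simp only [eq_nil_iff_of_mem_words hv]
    split_ifs <;> ring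

end WordSums

/-! ### From words back to permutations -/

section OneLineNotation

theorem card_filter_univ_prod {α β : Type*} [Fintype α] [Fintype β] (p : α × β → Prop)
    [DecidablePred p] : #{x : α × β | p x} = ∑ a, #{b : β | p (a, b)} := by
  simp only [Finset.card_filter]
  exact Fintype.sum_prod_type _

theorem countP_ofFn {n : ℕ} (f : Fin n → ℕ) (p : ℕ → Prop) [DecidablePred p] :
    (List.ofFn f).countP p = #{i : Fin n | p (f i)} := by
  induction n with
  | zero => simp
  | succ n ih =>
    rw [List.ofFn_succ, List.countP_cons, ih, Fin.card_filter_univ_succ']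
    simp [add_comm]

theorem consecCount_ofFn {n : ℕ} (r : ℕ → ℕ → Prop) [DecidableRel r] (f : Fin n → ℕ) :
    consecCount r (List.ofFn f) =
      #{i : Fin n | ∃ i' : Fin n, i'.val = i.val + 1 ∧ r (f i) (f i')} := by
  induction n with
  | zero => simp [consecCount]
  | succ n ih =>
    specialize ih (fun i => f i.succ)
    rw [Fin.card_filter_univ_succ', List.ofFn_succ]
    simp only [Fin.exists_fin_succ, Fin.val_zero, Fin.val_succ, Nat.add_right_cancel_iff]
    rcases n with _ | n
    · simp [consecCount]
    · rw [List.ofFn_succ] at ih ⊢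
      rw [consecCount, ih]
      simp [Fin.exists_fin_succ]
      rfl

/-- Induction on `n`, separating the occurrences whose adjacent pair starts at position `0`. -/
theorem vincCount_ofFn {n : ℕ} (P : ℕ → ℕ → ℕ → Prop) [∀ x y, DecidablePred (P x y)]
    (f : Fin n → ℕ) :
    vincCount P (List.ofFn f) = #{x : Fin n × Fin n | ∃ i' : Fin n, i'.val = x.1.val + 1 ∧
      i' < x.2 ∧ P (f x.1) (f i') (f x.2)} := by
  induction n with
  | zero => simp [vincCount]
  | succ n ih =>
    specialize ih (fun i => f i.succ)
    rw [card_filter_univ_prod] at ih ⊢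
    rw [Fin.sum_univ_succ, List.ofFn_succ]
    simp only [Fin.card_filter_univ_succ', Fin.exists_fin_succ, Fin.val_zero,
      Fin.val_succ, Nat.add_right_cancel_iff, Fin.not_lt_zero, Fin.succ_lt_succ_iff]
    rcases n with _ | n
    · simp [vincCount]
    · rw [List.ofFn_succ] at ih ⊢
      rw [vincCount, ih, countP_ofFn, Fin.card_filter_univ_succ']
      simp [Fin.exists_fin_succ]
      rfl

theorem wordAvoids231_ofFn {n : ℕ} (f : Fin n → ℕ) :
    WordAvoids231 (List.ofFn f) ↔
      ∀ i j k : Fin n, i < j → j < k → ¬ (f k < f i ∧ f i < f j) := by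
  induction n with
  | zero => simp [WordAvoids231]
  | succ n ih =>
    rw [List.ofFn_succ, WordAvoids231, ih, List.pairwise_ofFn]
    simp only [Fin.forall_fin_succ, Fin.not_lt_zero, Fin.succ_lt_succ_iff, Fin.succ_pos,
      false_imp_iff, imp_true_iff, true_and, forall_true_left]

variable {n : ℕ}

theorem avoids_231_iff (π : Equiv.Perm (Fin n)) :
    Avoids π ![2, 3, 1] ↔ ∀ i j k : Fin n, i < j → j < k → ¬ (π k < π i ∧ π i < π j) := by
  constructor
  · intro h i j k hij hjk hv
    refine h ⟨![i, j, k], ?_, ?_⟩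
    · rw [Fin.strictMono_iff_lt_succ]
      intro a
      fin_cases a
      exacts [hij, hjk]
    · have h3 := hv.1.trans hv.2
      intro a b
      fin_cases a <;> fin_cases b <;> simp [hv.1, hv.2, h3, hv.1.le, hv.2.le, h3.le]
  · rintro h ⟨f, hf, hp⟩
    refine h (f 0) (f 1) (f 2) (hf (by decide)) (hf (by decide)) ⟨?_, ?_⟩
    · exact (hp 2 0).2 (by decide)
    · exact (hp 0 1).2 (by decide)

/-- The one-line notation of a permutation. -/
def toWord (π : Equiv.Perm (Fin n)) : List ℕ := List.ofFn fun i => (π i).val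

theorem mem_avoiders {k : ℕ} {p : Fin k → ℕ} {π : Equiv.Perm (Fin n)} :
    π ∈ avoiders n p ↔ Avoids π p := by
  simp [avoiders]

theorem sum_avoiders_231 {M : Type*} [AddCommMonoid M] (F : List ℕ → M) :
    ∑ π ∈ avoiders n ![2, 3, 1], F (toWord π) = ∑ l ∈ words 0 n, F l := by
  have hav : ∀ π : Equiv.Perm (Fin n), Avoids π ![2, 3, 1] ↔ WordAvoids231 (toWord π) := by
    intro π
    rw [avoids_231_iff, toWord, wordAvoids231_ofFn]
    simp only [Fin.lt_def]
  refine Finset.sum_bij (fun π _ => toWord π) ?_ ?_ ?_ (fun _ _ => rfl)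
  · intro π hπ
    refine mem_words.2 ⟨?_, (hav π).1 (mem_avoiders.1 hπ)⟩
    rw [← List.range_eq_range', List.perm_ext_iff_of_nodup _ List.nodup_range]
    · intro a
      rw [toWord, List.mem_ofFn, List.mem_range]
      constructor
      · rintro ⟨i, rfl⟩
        exact (π i).isLt
      · exact fun ha => ⟨π.symm ⟨a, ha⟩, by simp⟩
    · exact List.nodup_ofFn.2 (Fin.val_injective.comp π.injective)
  · intro π _ σ _ h
    have := List.ofFn_injective h
    ext i
    exact congrFun this i
  · intro l hl
    obtain ⟨hp, ha⟩ := mem_words.1 hl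
    have hlen : l.length = n := length_of_mem_words hl
    subst hlen
    have hnd : l.Nodup := hp.nodup_iff.2 List.nodup_range'
    have hlt : ∀ i : Fin l.length, l.get i < l.length := fun i => by
      have := (mem_of_mem_words hl).1 (l.get_mem i)
      omega
    have hinj : Function.Injective fun i : Fin l.length => (⟨l.get i, hlt i⟩ : Fin l.length) :=
      fun i j h => hnd.injective_get (Fin.mk.inj h)
    let π : Equiv.Perm (Fin l.length) :=
      Equiv.ofBijective _ (Finite.injective_iff_bijective.1 hinj)
    have hπ : toWord π = l := List.ofFn_get l
    exact ⟨π, mem_avoiders.2 ((hav π).2 (hπ.symm ▸ ha)), hπ⟩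

/-- The number of ascents. -/
def asc (π : Equiv.Perm (Fin n)) : ℕ :=
  #{i : Fin n | ∃ i' : Fin n, i'.val = i.val + 1 ∧ π i < π i'}

theorem wordDes_toWord (π : Equiv.Perm (Fin n)) : wordDes (toWord π) = des π :=
  consecCount_ofFn _ _

theorem wordAsc_toWord (π : Equiv.Perm (Fin n)) : wordAsc (toWord π) = asc π :=
  consecCount_ofFn _ _

theorem word31_2_toWord (π : Equiv.Perm (Fin n)) : word31_2 (toWord π) = vinc31_2 π :=
  vincCount_ofFn _ _

theorem word13_2_toWord (π : Equiv.Perm (Fin n)) : word13_2 (toWord π) = vinc13_2 π :=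
  vincCount_ofFn _ _

/-- On permutations avoiding `231`, admissible star inversions `(i, j)` are the occurrences
`(i - 1, i, j)` of `13-2`. -/
theorem adiStar_eq_vinc13_2 {π : Equiv.Perm (Fin n)} (h : Avoids π ![2, 3, 1]) :
    adiStar π = vinc13_2 π := by
  rw [avoids_231_iff] at h
  symm
  refine Finset.card_bij'
    (fun x hx => (⟨x.1.val + 1, by
      obtain ⟨i', h1, -⟩ := (Finset.mem_filter.1 hx).2
      omega⟩, x.2))
    (fun x _ => (⟨x.1.val - 1, by omega⟩, x.2)) ?_ ?_ ?_ ?_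
  · rintro ⟨i, j⟩ hx
    obtain ⟨i', h1, h2, h3, h4⟩ := (Finset.mem_filter.1 hx).2
    have hi : i.val + 1 < n := h1 ▸ i'.isLt
    obtain rfl : i' = ⟨i.val + 1, hi⟩ := Fin.ext h1
    exact Finset.mem_filter.2 ⟨Finset.mem_univ _, h2, h4, Or.inl ⟨i, rfl, h3.trans h4⟩⟩
  · rintro ⟨i, j⟩ hx
    obtain ⟨h1, h2, h3⟩ : i < j ∧ π j < π i ∧ _ := (Finset.mem_filter.1 hx).2
    -- A letter above `π i` between positions `i` and `j` would complete a `231`, so only the first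
    -- alternative survives.
    have h3' : ∃ i' : Fin n, i'.val + 1 = i.val ∧ π i' < π i :=
      h3.resolve_right fun ⟨l, hil, hlj, hl⟩ => h i l j hil hlj ⟨h2, hl⟩
    obtain ⟨i', h4, h5⟩ := h3'
    have h6 : (⟨i.val - 1, by omega⟩ : Fin n) = i' := Fin.ext (by simp only; omega)
    have h7 : i' < i := Fin.lt_def.2 (by omega)
    have h8 : π i' ≠ π j := fun e => by
      have := π.injective e
      exact absurd (h7.trans h1) (by simp [this])
    -- Otherwise positions `i'`, `i`, `j` would carry a `231`.
    have h9 : π i' < π j :=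
      lt_of_le_of_ne (not_lt.1 fun hlt => h i' i j h7 h1 ⟨hlt, h5⟩) h8
    simp only [h6]
    exact Finset.mem_filter.2 ⟨Finset.mem_univ _, i, h4.symm, h1, h9, h2⟩
  · rintro ⟨i, j⟩ hx
    simp
  · rintro ⟨i, j⟩ hx
    obtain ⟨h1, h2, h3⟩ : i < j ∧ π j < π i ∧ _ := (Finset.mem_filter.1 hx).2
    have h3' : ∃ i' : Fin n, i'.val + 1 = i.val ∧ π i' < π i :=
      h3.resolve_right fun ⟨l, hil, hlj, hl⟩ => h i l j hil hlj ⟨h2, hl⟩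
    obtain ⟨i', h4, -⟩ := h3'
    refine Prod.ext (Fin.ext ?_) rfl
    simp only
    omega

end OneLineNotation

/-! ### Complement and reverse-complement -/

section Symmetry

variable {n : ℕ}

theorem avoids_revPerm_mul_iff {k : ℕ} {p p' : Fin k → ℕ}
    (h : ∀ a b, p a < p b ↔ p' b < p' a) (π : Equiv.Perm (Fin n)) :
    Avoids (Fin.revPerm * π) p ↔ Avoids π p' := by
  unfold Avoids
  simp only [Equiv.Perm.mul_apply, Fin.revPerm_apply, Fin.rev_lt_rev, h]
  refine not_congr (exists_congr fun f => and_congr_right fun _ => ?_)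
  exact forall_comm

theorem avoids_revPerm_conj_iff {k : ℕ} {p p' : Fin k → ℕ}
    (h : ∀ a b, p a < p b ↔ p' b.rev < p' a.rev) (π : Equiv.Perm (Fin n)) :
    Avoids (Fin.revPerm * π * Fin.revPerm) p ↔ Avoids π p' := by
  unfold Avoids
  simp only [Equiv.Perm.mul_apply, Fin.revPerm_apply, Fin.rev_lt_rev, h]
  refine not_congr ⟨?_, ?_⟩
  · rintro ⟨f, hf, hp⟩
    refine ⟨fun a => (f a.rev).rev, fun a b hab => ?_, fun a b => ?_⟩
    · exact Fin.rev_lt_rev.2 (hf (Fin.rev_lt_rev.2 hab))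
    · simpa using hp b.rev a.rev
  · rintro ⟨f, hf, hp⟩
    refine ⟨fun a => (f a.rev).rev, fun a b hab => ?_, fun a b => ?_⟩
    · exact Fin.rev_lt_rev.2 (hf (Fin.rev_lt_rev.2 hab))
    · simpa using hp b.rev a.rev

theorem sum_avoiders_complement {M : Type*} [AddCommMonoid M] {k : ℕ} {p p' : Fin k → ℕ}
    (h : ∀ a b, p a < p b ↔ p' b < p' a) (F : Equiv.Perm (Fin n) → M) :
    ∑ π ∈ avoiders n p, F π = ∑ π ∈ avoiders n p', F (Fin.revPerm * π) := by
  symm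
  refine Finset.sum_equiv (Equiv.mulLeft Fin.revPerm) (fun π => ?_) (fun π _ => rfl)
  rw [mem_avoiders, mem_avoiders, Equiv.coe_mulLeft, avoids_revPerm_mul_iff h]

theorem sum_avoiders_reverse_complement {M : Type*} [AddCommMonoid M] {k : ℕ} {p p' : Fin k → ℕ}
    (h : ∀ a b, p a < p b ↔ p' b.rev < p' a.rev) (F : Equiv.Perm (Fin n) → M) :
    ∑ π ∈ avoiders n p, F π = ∑ π ∈ avoiders n p', F (Fin.revPerm * π * Fin.revPerm) := by
  symm
  refine Finset.sum_equiv ((Equiv.mulLeft Fin.revPerm).trans (Equiv.mulRight Fin.revPerm))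
    (fun π => ?_) (fun π _ => rfl)
  rw [mem_avoiders, mem_avoiders, Equiv.trans_apply, Equiv.coe_mulLeft, Equiv.coe_mulRight,
    avoids_revPerm_conj_iff h]

theorem des_complement (π : Equiv.Perm (Fin n)) : des (Fin.revPerm * π) = asc π := by
  simp [des, asc]

theorem vinc31_2_complement (π : Equiv.Perm (Fin n)) :
    vinc31_2 (Fin.revPerm * π) = vinc13_2 π := by
  simp only [vinc31_2, vinc13_2, Equiv.Perm.mul_apply, Fin.revPerm_apply, Fin.rev_lt_rev]
  simp only [and_comm]

theorem vinc13_2_complement (π : Equiv.Perm (Fin n)) :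
    vinc13_2 (Fin.revPerm * π) = vinc31_2 π := by
  simp only [vinc31_2, vinc13_2, Equiv.Perm.mul_apply, Fin.revPerm_apply, Fin.rev_lt_rev]
  simp only [and_comm]

/-- Reversal sends the adjacent pair `(i, i + 1)` to an adjacent pair whose left end is the image of
`i + 1`, so `Fin.rev` does not match the index sets directly. Indexing adjacent pairs in `Fin (n +
1)` by `Fin n` repairs this: there reversal is again `Fin.rev`. -/
theorem card_filter_consecutive_rev (P : Fin n → Fin n → Prop) [DecidableRel P] :
    #{i : Fin n | ∃ i' : Fin n, i'.val = i.val + 1 ∧ P i i'} =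
      #{i : Fin n | ∃ i' : Fin n, i'.val = i.val + 1 ∧ P i'.rev i.rev} := by
  rcases n with _ | n
  · rfl
  have key : ∀ (Q : Fin (n + 1) → Fin (n + 1) → Prop) [DecidableRel Q],
      #{i : Fin (n + 1) | ∃ i' : Fin (n + 1), i'.val = i.val + 1 ∧ Q i i'} =
        #{i : Fin n | Q i.castSucc i.succ} := by
    intro Q _
    symm
    refine Finset.card_bij (fun i _ => i.castSucc) ?_ ?_ ?_
    · intro i hi
      simp only [Finset.mem_filter, Finset.mem_univ, true_and] at hi ⊢
      exact ⟨i.succ, by simp, hi⟩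
    · exact fun i _ j _ h => Fin.castSucc_injective _ h
    · intro i hi
      simp only [Finset.mem_filter, Finset.mem_univ, true_and] at hi
      obtain ⟨i', h1, h2⟩ := hi
      have h3 : (⟨i.val, by omega⟩ : Fin n).castSucc = i := rfl
      have h4 : (⟨i.val, by omega⟩ : Fin n).succ = i' := Fin.ext h1.symm
      exact ⟨⟨i.val, by omega⟩, by simpa [h3, h4] using h2, rfl⟩
  rw [key, key]
  refine Finset.card_equiv Fin.revPerm fun i => ?_
  simp [Fin.rev_castSucc, Fin.rev_succ]

theorem card_filter_vincular_rev (P : Fin n → Fin n → Fin n → Prop)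
    [∀ i i', DecidablePred (P i i')] :
    #{x : Fin n × Fin n | ∃ i' : Fin n, i'.val = x.1.val + 1 ∧ P x.1 i' x.2} =
      #{x : Fin n × Fin n | ∃ i' : Fin n, i'.val = x.1.val + 1 ∧ P i'.rev x.1.rev x.2.rev} := by
  have key : ∀ (Q : Fin n → Fin n → Fin n → Prop) [∀ i i', DecidablePred (Q i i')],
      #{x : Fin n × Fin n | ∃ i' : Fin n, i'.val = x.1.val + 1 ∧ Q x.1 i' x.2} =
        ∑ j, #{i : Fin n | ∃ i' : Fin n, i'.val = i.val + 1 ∧ Q i i' j} := by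
    intro Q _
    simp only [Finset.card_filter]
    exact Fintype.sum_prod_type_right _
  rw [key, key fun i i' j => P i'.rev i.rev j.rev, ← Equiv.sum_comp Fin.revPerm]
  exact Finset.sum_congr rfl fun j _ => card_filter_consecutive_rev fun i i' => P i i' j.rev

theorem des_reverse_complement (π : Equiv.Perm (Fin n)) :
    des (Fin.revPerm * π * Fin.revPerm) = des π := by
  rw [des, card_filter_consecutive_rev]
  simp [des]

theorem vinc2_31_reverse_complement (π : Equiv.Perm (Fin n)) :
    vinc2_31 (Fin.revPerm * π * Fin.revPerm) = vinc31_2 π := by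
  generalize hσ : Fin.revPerm * π * Fin.revPerm = σ
  refine (card_filter_vincular_rev fun i i' j => j < i ∧ σ i' < σ j ∧ σ j < σ i).trans ?_
  subst hσ
  simp [vinc31_2, and_comm]

theorem vinc2_13_reverse_complement (π : Equiv.Perm (Fin n)) :
    vinc2_13 (Fin.revPerm * π * Fin.revPerm) = vinc13_2 π := by
  generalize hσ : Fin.revPerm * π * Fin.revPerm = σ
  refine (card_filter_vincular_rev fun i i' j => j < i ∧ σ i < σ j ∧ σ j < σ i').trans ?_
  subst hσ
  simp [vinc13_2, and_comm]

/-- The inversion `(i, j)` corresponds to `(j.rev, i.rev)`. An ascent after `j` becomes an ascent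
before `j.rev`, and a missing right neighbour becomes a missing left one, so the two boundary
conventions agree. -/
theorem adi_reverse_complement (π : Equiv.Perm (Fin n)) :
    adi (Fin.revPerm * π * Fin.revPerm) = adiStar π := by
  refine Finset.card_equiv ((Equiv.prodComm _ _).trans (Fin.revPerm.prodCongr Fin.revPerm)) ?_
  rintro ⟨i, j⟩
  simp only [Finset.mem_filter, Finset.mem_univ, true_and, Equiv.Perm.mul_apply,
    Fin.revPerm_apply, Fin.rev_lt_rev, Equiv.trans_apply, Equiv.prodComm_apply, Prod.swap_prod_mk,
    Equiv.prodCongr_apply, Prod.map_apply]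
  refine and_congr_right fun hij => and_congr_right fun hv => or_congr ?_ ?_
  · rw [Fin.rev_surjective.exists]
    refine exists_congr fun i' => and_congr ?_ (by rw [Fin.rev_rev])
    simp only [Fin.val_rev]
    omega
  · rw [Fin.rev_surjective.exists]
    simp only [Fin.rev_rev]
    refine exists_congr fun l => ?_
    rw [← Fin.rev_lt_rev, ← Fin.rev_lt_rev (i := j)]
    simp only [Fin.rev_rev]
    tauto

end Symmetry

/-! ### The five basic pairs -/

section Main

variable {R : Type*} [CommRing R] (t q : R) (n : ℕ)

theorem avoidSum_reverse_complement {p p' : Fin 3 → ℕ}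
    (h : ∀ a b, p a < p b ↔ p' b.rev < p' a.rev) {stat stat' : Equiv.Perm (Fin n) → ℕ}
    (hs : ∀ π, stat (Fin.revPerm * π * Fin.revPerm) = stat' π) :
    avoidSum t q p stat = avoidSum t q p' stat' := by
  rw [avoidSum, sum_avoiders_reverse_complement h]
  simp only [hs, des_reverse_complement, avoidSum]

theorem qtCatalan_eq_avoidSum_231_13_2 :
    qtCatalan n t q = avoidSum (n := n) t q ![2, 3, 1] vinc13_2 := by
  rw [qtCatalan_eq_sum_des_13_2, ← sum_avoiders_231]
  simp only [wordDes_toWord, word13_2_toWord, avoidSum]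

theorem qtCatalan_eq_avoidSum_231_adiStar :
    qtCatalan n t q = avoidSum (n := n) t q ![2, 3, 1] adiStar := by
  rw [qtCatalan_eq_avoidSum_231_13_2]
  exact Finset.sum_congr rfl fun π hπ => by rw [adiStar_eq_vinc13_2 (mem_avoiders.1 hπ)]

theorem qtCatalan_eq_avoidSum_231_31_2 :
    qtCatalan n t q = avoidSum (n := n) t q ![2, 3, 1] vinc31_2 := by
  rw [qtCatalan_eq_sum_des_31_2, ← sum_avoiders_231]
  simp only [wordDes_toWord, word31_2_toWord, avoidSum]

theorem qtCatalan_eq_avoidSum_213_31_2 :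
    qtCatalan n t q = avoidSum (n := n) t q ![2, 1, 3] vinc31_2 := by
  rw [qtCatalan_eq_sum_asc_13_2, ← sum_avoiders_231, avoidSum,
    sum_avoiders_complement (p := ![2, 1, 3]) (p' := ![2, 3, 1]) (by decide)]
  simp only [wordAsc_toWord, word13_2_toWord, des_complement, vinc31_2_complement]

theorem qtCatalan_eq_avoidSum_213_13_2 :
    qtCatalan n t q = avoidSum (n := n) t q ![2, 1, 3] vinc13_2 := by
  rw [qtCatalan_eq_sum_asc_31_2, ← sum_avoiders_231, avoidSum,
    sum_avoiders_complement (p := ![2, 1, 3]) (p' := ![2, 3, 1]) (by decide)]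
  simp only [wordAsc_toWord, word31_2_toWord, des_complement, vinc13_2_complement]

end Main

end QTCatalan

theorem theorem1p1 {R : Type*} [CommRing R] (t q : R) (n : ℕ) :
    QTCatalan.qtCatalan n t q = QTCatalan.avoidSum (n := n) t q ![2, 3, 1] QTCatalan.vinc13_2 ∧
    QTCatalan.qtCatalan n t q = QTCatalan.avoidSum (n := n) t q ![2, 3, 1] QTCatalan.adiStar ∧
    QTCatalan.qtCatalan n t q = QTCatalan.avoidSum (n := n) t q ![3, 1, 2] QTCatalan.vinc2_13 ∧
    QTCatalan.qtCatalan n t q = QTCatalan.avoidSum (n := n) t q ![3, 1, 2] QTCatalan.adi ∧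
    QTCatalan.qtCatalan n t q = QTCatalan.avoidSum (n := n) t q ![2, 1, 3] QTCatalan.vinc31_2 ∧
    QTCatalan.qtCatalan n t q = QTCatalan.avoidSum (n := n) t q ![1, 3, 2] QTCatalan.vinc2_31 ∧
    QTCatalan.qtCatalan n t q = QTCatalan.avoidSum (n := n) t q ![2, 3, 1] QTCatalan.vinc31_2 ∧
    QTCatalan.qtCatalan n t q = QTCatalan.avoidSum (n := n) t q ![3, 1, 2] QTCatalan.vinc2_31 ∧
    QTCatalan.qtCatalan n t q = QTCatalan.avoidSum (n := n) t q ![2, 1, 3] QTCatalan.vinc13_2 ∧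
    QTCatalan.qtCatalan n t q = QTCatalan.avoidSum (n := n) t q ![1, 3, 2] QTCatalan.vinc2_13 := by
  open QTCatalan in
  refine ⟨qtCatalan_eq_avoidSum_231_13_2 t q n, qtCatalan_eq_avoidSum_231_adiStar t q n, ?_, ?_,
    qtCatalan_eq_avoidSum_213_31_2 t q n, ?_, qtCatalan_eq_avoidSum_231_31_2 t q n, ?_,
    qtCatalan_eq_avoidSum_213_13_2 t q n, ?_⟩
  · rw [avoidSum_reverse_complement t q n (p' := ![2, 3, 1]) (by decide)
      vinc2_13_reverse_complement]
    exact qtCatalan_eq_avoidSum_231_13_2 t q n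
  · rw [avoidSum_reverse_complement t q n (p' := ![2, 3, 1]) (by decide) adi_reverse_complement]
    exact qtCatalan_eq_avoidSum_231_adiStar t q n
  · rw [avoidSum_reverse_complement t q n (p' := ![2, 1, 3]) (by decide)
      vinc2_31_reverse_complement]
    exact qtCatalan_eq_avoidSum_213_31_2 t q n
  · rw [avoidSum_reverse_complement t q n (p' := ![2, 3, 1]) (by decide)
      vinc2_31_reverse_complement]
    exact qtCatalan_eq_avoidSum_231_31_2 t q n
  · rw [avoidSum_reverse_complement t q n (p' := ![2, 1, 3]) (by decide)
      vinc2_13_reverse_complement]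
    exact qtCatalan_eq_avoidSum_213_13_2 t q n
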